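/- Let $n \ge 1$, let $N \subsetneq N_*$ be finite index sets, $p := \#N$, $p_* := \#N_*$, and suppose $0 \le p < p_* < n$. For $y \in \mathbb{R}^n$, vectors $x_\nu \in \mathbb{R}^n$ $(\nu \in N_*)$ and $S \subseteq N_*$ let $\mathrm{SS}_S := \|y - \widehat{y}_S\|^2$, where $\|\cdot\|$ is the Euclidean norm and $\widehat{y}_S$ is the orthogonal projection of $y$ onto $\mathrm{span}(x_\nu : \nu \in S)$ (which is $\{0\}$ if $S = \emptyset$). (i) Suppose that the $p+1$ vectors $y$ and $x_\nu$, $\nu \in N$, are fixed and linearly independent. Let $z_\nu$, $\nu \in N_* \setminus N$, be independent random vectors with distribution $\mathcal{N}_n(0, I_n)$, and let $\mathrm{SS}^{z}_{N_*}$ be the sum of squared residuals obtained from $\mathrm{SS}_{N_*}$ when $x_\nu$ is replaced with $z_\nu$ for every $\nu \in N_* \setminus N$. Then $\mathrm{SS}^{z}_{N_*}$ is a random variable such that \[ \frac{\mathrm{SS}^{z}_{N_*}}{\mathrm{SS}_N} \ \sim \ \mathrm{Beta}\Bigl(\frac{n-p_*}{2}, \frac{p_*-p}{2}\Bigr) .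 \] (ii) Suppose in addition that the $p_*+1$ vectors $y$ and $x_\nu$, $\nu \in N_*$, are fixed and linearly independent. Let \[ F := \frac{(\mathrm{SS}_N - \mathrm{SS}_{N_*})/(p_*-p)}{\mathrm{SS}_{N_*}/(n-p_*)} \] be the F test statistic, and let $\pi := 1 - F_{p_*-p,\,n-p_*}(F)$ be the classical p-value of the F test, where $F_{k,\ell}$ is the distribution function of Fisher's F distribution with $k$ and $\ell$ degrees of freedom. With the distribution function $B_{a,b}$ of $\mathrm{Beta}(a,b)$, \[ \pi \ = \ B_{(n-p_*)/2,\,(p_*-p)/2}\Bigl(\frac{\mathrm{SS}_{N_*}}{\mathrm{SS}_N}\Bigr) \ = \ \mathbb{P}\Bigl(\frac{\mathrm{SS}^{z}_{N_*}}{\mathrm{SS}_N} \le \frac{\mathrm{SS}_{N_*}}{\mathrm{SS}_N}\Bigr) \ = \ \mathbb{P}\bigl(\mathrm{SS}_N - \mathrm{SS}^{z}_{N_*} \ge \mathrm{SS}_N - \mathrm{SS}_{N_*}\bigr) . \] -/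

import Mathlib

open MeasureTheory ProbabilityTheory

noncomputable section

/-- The linear space `V_S` spanned by the regressors `x ν`, `ν ∈ S`. -/
def regressorSpan {n : ℕ} {ι : Type*} (x : ι → EuclideanSpace ℝ (Fin n)) (S : Finset ι) :
    Submodule ℝ (EuclideanSpace ℝ (Fin n)) :=
  Submodule.span ℝ (x '' (S : Set ι))

/-- The least squares fit: the orthogonal projection of `y` onto `V_S`. -/
def fittedVector {n : ℕ} {ι : Type*} (y : EuclideanSpace ℝ (Fin n))
    (x : ι → EuclideanSpace ℝ (Fin n)) (S : Finset ι) : EuclideanSpace ℝ (Fin n) :=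
  (regressorSpan x S).starProjection y

/-- The sum of squared residuals `SS_S`. -/
def residualSS {n : ℕ} {ι : Type*} (y : EuclideanSpace ℝ (Fin n))
    (x : ι → EuclideanSpace ℝ (Fin n)) (S : Finset ι) : ℝ :=
  ‖y - fittedVector y x S‖ ^ 2

/-- The regressors `x ν` for `ν ∈ N`, all the others being replaced by `z ν`. -/
def replaceRegressors {n : ℕ} {ι : Type*} [DecidableEq ι] (N : Finset ι)
    (x z : ι → EuclideanSpace ℝ (Fin n)) : ι → EuclideanSpace ℝ (Fin n) :=
  fun ν => if ν ∈ N then x ν else z ν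

/-- The family consisting of `y` (at `none`) and the vectors `x ν`, `ν ∈ S`. -/
def responseAndRegressors {n : ℕ} {ι : Type*} (y : EuclideanSpace ℝ (Fin n))
    (x : ι → EuclideanSpace ℝ (Fin n)) (S : Finset ι) : Option S → EuclideanSpace ℝ (Fin n) :=
  fun o => o.elim y (fun ν => x ν)

/-- The chi-squared distribution with `k` degrees of freedom: the law of the sum of squares of
`k` independent standard Gaussian random variables. -/
def chiSquaredMeasure (k : ℕ) : Measure ℝ :=
  (Measure.pi (fun _ : Fin k => gaussianReal 0 1)).map (fun g => ∑ i, g i ^ 2)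

/-- Fisher's F distribution with `k` and `l` degrees of freedom: the law of `(X / k) / (Y / l)` with
independent chi-squared random variables `X`, `Y` with `k` and `l` degrees of freedom. -/
def fisherMeasure (k l : ℕ) : Measure ℝ :=
  ((chiSquaredMeasure k).prod (chiSquaredMeasure l)).map (fun w => (w.1 / k) / (w.2 / l))

/-- The F test statistic for comparing the regressors in `N` with those in `Nstar ⊇ N`. -/
def fStatistic {n : ℕ} {ι : Type*} (y : EuclideanSpace ℝ (Fin n))
    (x : ι → EuclideanSpace ℝ (Fin n)) (N Nstar : Finset ι) : ℝ :=
  ((residualSS y x N - residualSS y x Nstar) / ((Nstar.card : ℝ) - N.card)) /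
    (residualSS y x Nstar / ((n : ℝ) - Nstar.card))

/-- The classical p-value `1 - F_{p_* - p, n - p_*}(F)` of the F test. Natural subtraction is the
usual one when `N ⊆ Nstar` and `Nstar.card ≤ n`. -/
def fTestPValue {n : ℕ} {ι : Type*} (y : EuclideanSpace ℝ (Fin n))
    (x : ι → EuclideanSpace ℝ (Fin n)) (N Nstar : Finset ι) : ℝ :=
  1 - cdf (fisherMeasure (Nstar.card - N.card) (n - Nstar.card)) (fStatistic y x N Nstar)

end

/-! Let `U` be the span of the retained regressors and `W` the sum of `U` and the span of the
Gaussian vectors `z`. The law of the ratio of squared residuals modulo `W` and modulo `U` is the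
same for every response outside `U`: after rescaling, an orthogonal map fixing `U` pointwise carries
one residual modulo `U` to any other, and it preserves the law of `z`
(`map_residual_ratio_pi_stdGaussian_congr`).

Hence the fixed response may be replaced with a standard Gaussian vector `g` independent of `z`, and
by Fubini `z` may be frozen instead. Almost surely `W` has the maximal dimension
(`ae_finrank_sup_span_stdGaussian`). For such a `W` the ratio is `A / (A + B)`, where `A` and `B`
are the squared norms of the projections of `g` onto `Wᗮ` and `Uᗮ ⊓ W`: independent chi-squared
variables, so the ratio is beta (`map_residual_ratio_stdGaussian`). This last fact is the beta-gamma
relation `map_div_add_add_prod_gammaMeasure`.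

For the p-value, `F` is a decreasing function of the observed ratio, and the representation `A / (A
+ B)` turns the upper Fisher tail into a lower beta tail (`one_sub_cdf_fisherMeasure`). -/

/-! ### Beta-gamma calculus -/

/-- Substituting `x = y * s / (1 - s)`, with Jacobian `y / (1 - s) ^ 2`, gives `x + y = y / (1 -
s)`. The two exponentials therefore merge into one of rate `r / (1 - s)`, and the powers of `s` and
`1 - s` left over form the beta density. -/
lemma gammaPDFReal_mul_gammaPDFReal {a b r s y : ℝ} (ha : 0 < a) (hb : 0 < b) (hr : 0 < r)
    (hs : s ∈ Set.Ioo (0 : ℝ) 1) (hy : 0 < y) :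
    y / (1 - s) ^ 2 * (gammaPDFReal a r (y * s / (1 - s)) * gammaPDFReal b r y) =
      betaPDFReal a b s * gammaPDFReal (a + b) (r / (1 - s)) y := by
  obtain ⟨hs0, hs1⟩ := hs
  have hq : 0 < 1 - s := by linarith
  have hGa := (Real.Gamma_pos_of_pos ha).ne'
  have hGb := (Real.Gamma_pos_of_pos hb).ne'
  have hGab := (Real.Gamma_pos_of_pos (add_pos ha hb)).ne'
  have hexp : Real.exp (-(r / (1 - s) * y)) =
      Real.exp (-(r * (y * s / (1 - s)))) * Real.exp (-(r * y)) := by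
    rw [← Real.exp_add]
    congr 1
    field_simp
    ring
  rw [gammaPDFReal, gammaPDFReal, gammaPDFReal, betaPDFReal, if_pos (by positivity),
    if_pos hy.le, if_pos hy.le, if_pos ⟨hs0, hs1⟩, hexp, beta,
    Real.div_rpow (by positivity) hq.le, Real.mul_rpow hy.le hs0.le, Real.div_rpow hr.le hq.le,
    Real.rpow_sub_one hy.ne', Real.rpow_sub_one hy.ne', Real.rpow_sub_one hy.ne',
    Real.rpow_sub_one hs0.ne', Real.rpow_sub_one hq.ne', Real.rpow_sub_one hq.ne',
    Real.rpow_add hy, Real.rpow_add hr, Real.rpow_add hq]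
  have h1 := (Real.rpow_pos_of_pos hq a).ne'
  have h2 := (Real.rpow_pos_of_pos hq b).ne'
  field_simp

lemma lintegral_Ioi_eq_lintegral_Ioo_div_one_sub {y : ℝ} (hy : 0 < y) (g : ℝ → ENNReal) :
    ∫⁻ x in Set.Ioi 0, g x =
      ∫⁻ s in Set.Ioo 0 1, ENNReal.ofReal (y / (1 - s) ^ 2) * g (y * s / (1 - s)) := by
  have himg : (fun s : ℝ => y * s / (1 - s)) '' Set.Ioo 0 1 = Set.Ioi 0 := by
    ext x
    constructor
    · rintro ⟨s, ⟨h0, h1⟩, rfl⟩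
      have : 0 < 1 - s := by linarith
      exact Set.mem_Ioi.2 (by positivity)
    · intro hx
      have hx : 0 < x := hx
      refine ⟨x / (x + y), ⟨by positivity, by rw [div_lt_one (by positivity)]; linarith⟩, ?_⟩
      have : 1 - x / (x + y) = y / (x + y) := by field_simp; ring
      simp only [this]
      field_simp
  rw [← himg, lintegral_image_eq_lintegral_abs_deriv_mul (f' := fun s => y / (1 - s) ^ 2)
    measurableSet_Ioo]
  · refine setLIntegral_congr_fun measurableSet_Ioo fun s hs => ?_
    rw [abs_of_nonneg (by positivity)]
  · intro s hs
    have hq : (1 - s) ≠ 0 := by have := hs.2; linarith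
    have h := ((hasDerivAt_id s).const_mul y).div ((hasDerivAt_id s).const_sub 1) hq
    refine (h.congr_deriv ?_).hasDerivWithinAt
    simp only [id]
    field_simp
    ring
  · intro s hs t ht hst
    have h1 : (1 - s) ≠ 0 := by have := hs.2; linarith
    have h2 : (1 - t) ≠ 0 := by have := ht.2; linarith
    simp only at hst
    field_simp at hst
    linarith

lemma lintegral_gammaPDF_mul (a r : ℝ) (g : ℝ → ENNReal) :
    ∫⁻ x, gammaPDF a r x * g x = ∫⁻ x in Set.Ioi 0, gammaPDF a r x * g x := by
  rw [setLIntegral_congr Ioi_ae_eq_Ici, ← lintegral_indicator measurableSet_Ici]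
  refine lintegral_congr fun x => ?_
  by_cases hx : 0 ≤ x
  · simp [hx]
  · simp [hx, gammaPDF_of_neg (not_le.1 hx)]

lemma lintegral_betaPDF_mul (a b : ℝ) (g : ℝ → ENNReal) :
    ∫⁻ x, betaPDF a b x * g x = ∫⁻ x in Set.Ioo 0 1, betaPDF a b x * g x := by
  rw [← lintegral_indicator measurableSet_Ioo]
  refine lintegral_congr fun x => ?_
  by_cases hx : x ∈ Set.Ioo (0 : ℝ) 1
  · simp [hx]
  · have : betaPDF a b x = 0 := by
      rw [betaPDF_eq, if_neg (show ¬(0 < x ∧ x < 1) from hx), ENNReal.ofReal_zero]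
    simp [hx, this]

/-- The rate is an inverse scale parameter. With `q = 1 - s` this passes from `y` to the sum `x + y
= y / (1 - s)` and removes the dependence of the rate on `s`. -/
lemma lintegral_gammaPDF_div_mul {a r q : ℝ} (hr : 0 < r) (hq : 0 < q) (g : ℝ → ENNReal) :
    ∫⁻ y in Set.Ioi 0, gammaPDF a (r / q) y * g (y / q) =
      ∫⁻ v in Set.Ioi 0, gammaPDF a r v * g v := by
  have himg : (fun v : ℝ => q * v) '' Set.Ioi 0 = Set.Ioi 0 := by
    simpa using Set.image_mul_left_Ioi hq (0 : ℝ)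
  conv_lhs => rw [← himg]
  rw [lintegral_image_eq_lintegral_abs_deriv_mul (f' := fun _ => q) measurableSet_Ioi
    (fun v _ => by simpa using ((hasDerivAt_id v).const_mul q).hasDerivWithinAt)
    ((mul_right_injective₀ hq.ne').injOn)]
  refine setLIntegral_congr_fun measurableSet_Ioi fun v hv => ?_
  have hv : 0 < v := hv
  rw [← mul_assoc, gammaPDF, ← ENNReal.ofReal_mul (by positivity), mul_div_cancel_left₀ _ hq.ne',
    abs_of_pos hq, gammaPDF]
  congr 2
  rw [gammaPDFReal, gammaPDFReal, if_pos (by positivity), if_pos hv.le,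
    Real.div_rpow hr.le hq.le, Real.mul_rpow hq.le hv.le, Real.rpow_sub_one hq.ne']
  have h1 := (Real.rpow_pos_of_pos hq a).ne'
  have h2 : r / q * (q * v) = r * v := by field_simp
  rw [h2]
  field_simp

/-- If `X` and `Y` are independent gamma random variables with the same rate, then `X / (X + Y)`
and `X + Y` are independent with a beta and a gamma distribution, respectively. -/
lemma map_div_add_add_prod_gammaMeasure {a b r : ℝ} (ha : 0 < a) (hb : 0 < b) (hr : 0 < r) :
    ((gammaMeasure a r).prod (gammaMeasure b r)).map (fun w => (w.1 / (w.1 + w.2), w.1 + w.2)) =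
      (betaMeasure a b).prod (gammaMeasure (a + b) r) := by
  have hpγ (c ρ : ℝ) : Measurable (gammaPDF c ρ) := (measurable_gammaPDFReal c ρ).ennreal_ofReal
  have hpβ : Measurable (betaPDF a b) := (measurable_betaPDFReal a b).ennreal_ofReal
  refine Measure.ext_of_lintegral _ fun h hh => ?_
  have hh1 : Measurable fun w : ℝ × ℝ => h (w.1 / (w.1 + w.2), w.1 + w.2) :=
    hh.comp (by fun_prop)
  have hm1 : Measurable fun w : ℝ × ℝ =>
      gammaPDF a r w.1 * gammaPDF b r w.2 * h (w.1 / (w.1 + w.2), w.1 + w.2) :=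
    (((hpγ a r).comp measurable_fst).mul ((hpγ b r).comp measurable_snd)).mul hh1
  have hm2 : Measurable fun w : ℝ × ℝ => betaPDF a b w.1 * gammaPDF (a + b) r w.2 * h w :=
    ((hpβ.comp measurable_fst).mul ((hpγ (a + b) r).comp measurable_snd)).mul hh
  rw [lintegral_map hh (by fun_prop), betaMeasure, gammaMeasure, gammaMeasure, gammaMeasure,
    prod_withDensity (hpγ a r) (hpγ b r), prod_withDensity hpβ (hpγ (a + b) r),
    lintegral_withDensity_eq_lintegral_mul _ (by fun_prop) hh1,
    lintegral_withDensity_eq_lintegral_mul _ (by fun_prop) hh]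
  simp only [Pi.mul_apply]
  rw [lintegral_prod_symm _ hm1.aemeasurable, lintegral_prod _ hm2.aemeasurable]
  have hpt : ∀ y : ℝ, 0 < y → ∀ s ∈ Set.Ioo (0 : ℝ) 1, ENNReal.ofReal (y / (1 - s) ^ 2) *
      (gammaPDF a r (y * s / (1 - s)) * gammaPDF b r y *
        h (y * s / (1 - s) / (y * s / (1 - s) + y), y * s / (1 - s) + y)) =
      betaPDF a b s * (gammaPDF (a + b) (r / (1 - s)) y * h (s, y / (1 - s))) := by
    intro y hy s hs
    have hq : 0 < 1 - s := by linarith [hs.2]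
    have h1 : y * s / (1 - s) + y = y / (1 - s) := by field_simp; ring
    have h2 : y * s / (1 - s) / (y / (1 - s)) = s := by field_simp
    rw [h1, h2, ← mul_assoc, ← mul_assoc (betaPDF a b s)]
    congr 1
    rw [gammaPDF, gammaPDF, ← ENNReal.ofReal_mul (gammaPDFReal_nonneg ha hr _),
      ← ENNReal.ofReal_mul (by positivity), gammaPDFReal_mul_gammaPDFReal ha hb hr hs hy,
      ENNReal.ofReal_mul (betaPDFReal_pos hs.1 hs.2 ha hb).le, betaPDF, gammaPDF]
  calc ∫⁻ y, ∫⁻ x, gammaPDF a r x * gammaPDF b r y * h (x / (x + y), x + y)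
      = ∫⁻ y, gammaPDF b r y * ∫⁻ x, gammaPDF a r x * h (x / (x + y), x + y) := by
        refine lintegral_congr fun y => ?_
        rw [← lintegral_const_mul' _ _ (by simp [gammaPDF])]
        exact lintegral_congr fun x => by ring
    _ = ∫⁻ y in Set.Ioi 0, ∫⁻ s in Set.Ioo 0 1,
          betaPDF a b s * (gammaPDF (a + b) (r / (1 - s)) y * h (s, y / (1 - s))) := by
        rw [lintegral_gammaPDF_mul]
        refine setLIntegral_congr_fun measurableSet_Ioi fun y hy => ?_
        rw [lintegral_gammaPDF_mul, ← lintegral_const_mul' _ _ (by simp [gammaPDF]),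
          lintegral_Ioi_eq_lintegral_Ioo_div_one_sub hy]
        refine setLIntegral_congr_fun measurableSet_Ioo fun s hs => ?_
        rw [← hpt y hy s hs]
        ring
    _ = ∫⁻ s in Set.Ioo 0 1, ∫⁻ y in Set.Ioi 0,
          betaPDF a b s * (gammaPDF (a + b) (r / (1 - s)) y * h (s, y / (1 - s))) := by
        -- Tonelli: `y` must be integrated with `s` held fixed, since the rescaling of `y` depends
        -- on `s`.
        rw [lintegral_lintegral_swap]
        refine Measurable.aemeasurable ?_
        have hγ : Measurable fun w : ℝ × ℝ => gammaPDF (a + b) (r / (1 - w.2)) w.1 := by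
          refine Measurable.ennreal_ofReal (Measurable.ite ?_ (by fun_prop) measurable_const)
          exact measurableSet_le measurable_const measurable_fst
        exact (hpβ.comp measurable_snd).mul (hγ.mul (hh.comp (by fun_prop)))
    _ = ∫⁻ s, betaPDF a b s * ∫⁻ v, gammaPDF (a + b) r v * h (s, v) := by
        rw [lintegral_betaPDF_mul]
        refine setLIntegral_congr_fun measurableSet_Ioo fun s hs => ?_
        have hq : 0 < 1 - s := by linarith [hs.2]
        rw [lintegral_const_mul' _ _ (by simp [betaPDF]), lintegral_gammaPDF_mul,
          ← lintegral_gammaPDF_div_mul hr hq fun v => h (s, v)]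
    _ = ∫⁻ s, ∫⁻ v, betaPDF a b s * gammaPDF (a + b) r v * h (s, v) := by
        refine lintegral_congr fun s => ?_
        rw [← lintegral_const_mul' _ _ (by simp [betaPDF])]
        exact lintegral_congr fun v => by ring

lemma map_div_add_prod_gammaMeasure {a b r : ℝ} (ha : 0 < a) (hb : 0 < b) (hr : 0 < r) :
    ((gammaMeasure a r).prod (gammaMeasure b r)).map (fun w => w.1 / (w.1 + w.2)) =
      betaMeasure a b := by
  have := isProbabilityMeasureBeta ha hb
  have := isProbabilityMeasure_gammaMeasure (add_pos ha hb) hr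
  have h := congrArg (Measure.map Prod.fst) (map_div_add_add_prod_gammaMeasure ha hb hr)
  rw [Measure.map_map measurable_fst (by fun_prop), Measure.map_fst_prod, measure_univ,
    one_smul] at h
  exact h

lemma map_add_prod_gammaMeasure {a b r : ℝ} (ha : 0 < a) (hb : 0 < b) (hr : 0 < r) :
    ((gammaMeasure a r).prod (gammaMeasure b r)).map (fun w => w.1 + w.2) =
      gammaMeasure (a + b) r := by
  have := isProbabilityMeasureBeta ha hb
  have := isProbabilityMeasure_gammaMeasure (add_pos ha hb) hr
  have h := congrArg (Measure.map Prod.snd) (map_div_add_add_prod_gammaMeasure ha hb hr)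
  rw [Measure.map_map measurable_snd (by fun_prop), Measure.map_snd_prod, measure_univ,
    one_smul] at h
  exact h

/-! ### Chi-squared laws as gamma laws -/

/-- The square of a standard Gaussian random variable has a gamma distribution. -/
lemma map_sq_gaussianReal :
    (gaussianReal 0 1).map (fun x => x ^ 2) = gammaMeasure (1 / 2) (1 / 2) := by
  have hpγ : Measurable (gammaPDF (1 / 2) (1 / 2)) :=
    (measurable_gammaPDFReal _ _).ennreal_ofReal
  refine Measure.ext_of_lintegral _ fun h hh => ?_
  have hh1 : Measurable fun x : ℝ => h (x ^ 2) := hh.comp (by fun_prop)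
  rw [lintegral_map hh (by fun_prop), gaussianReal_of_var_ne_zero _ one_ne_zero, gammaMeasure,
    lintegral_withDensity_eq_lintegral_mul _ (by fun_prop) hh1,
    lintegral_withDensity_eq_lintegral_mul _ hpγ hh]
  simp only [Pi.mul_apply]
  rw [lintegral_gammaPDF_mul]
  have himg : (fun x : ℝ => x ^ 2) '' Set.Ioi 0 = Set.Ioi 0 := by
    ext x
    constructor
    · rintro ⟨s, hs, rfl⟩
      have : 0 < s := hs
      exact Set.mem_Ioi.2 (by positivity)
    · intro hx
      exact ⟨√x, Real.sqrt_pos.2 hx, Real.sq_sqrt (le_of_lt hx)⟩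
  have hpt : ∀ x : ℝ, 0 < x → ENNReal.ofReal |2 * x| * (gammaPDF (1 / 2) (1 / 2) (x ^ 2) *
      h (x ^ 2)) = 2 * (gaussianPDF 0 1 x * h (x ^ 2)) := by
    intro x hx
    have h2 : (2 : ENNReal) = ENNReal.ofReal 2 := by simp
    rw [← mul_assoc, ← mul_assoc, h2, gammaPDF, gaussianPDF, ← ENNReal.ofReal_mul (by positivity),
      ← ENNReal.ofReal_mul (by positivity)]
    congr 2
    rw [abs_of_pos (by positivity), gammaPDFReal, if_pos (by positivity), gaussianPDFReal,
      Real.Gamma_one_half_eq, ← Real.sqrt_eq_rpow, ← Real.rpow_natCast x 2, ← Real.rpow_mul hx.le]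
    norm_num
    rw [Real.rpow_neg_one]
    have h3 : √2 ≠ 0 := by positivity
    have h4 : √Real.pi ≠ 0 := by have := Real.pi_pos; positivity
    have h5 : -(1 / 2 * x ^ 2) = -x ^ 2 / 2 := by ring
    rw [h5]
    field_simp
  conv_rhs => rw [← himg]
  rw [lintegral_image_eq_lintegral_abs_deriv_mul (f' := fun x => 2 * x) measurableSet_Ioi
    (fun x _ => by simpa using (hasDerivAt_pow 2 x).hasDerivWithinAt)
    (fun x hx y hy hxy => (pow_left_inj₀ (le_of_lt hx) (le_of_lt hy) two_ne_zero).1 hxy)]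
  -- Squaring is two-to-one: the factor 2 on the gamma side matches the two half-lines on the
  -- Gaussian side, which contribute equally by symmetry.
  rw [setLIntegral_congr_fun measurableSet_Ioi hpt,
    lintegral_const_mul' _ _ (by simp), ← lintegral_add_compl _ measurableSet_Ioi (A := Set.Ioi 0),
    two_mul]
  congr 1
  rw [Set.compl_Ioi, setLIntegral_congr Iio_ae_eq_Iic.symm]
  have hneg : (fun x : ℝ => -x) '' Set.Ioi 0 = Set.Iio 0 := by simp
  rw [← hneg, lintegral_image_eq_lintegral_abs_deriv_mul (f' := fun x => -1) measurableSet_Ioi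
    (fun x _ => (hasDerivAt_neg x).hasDerivWithinAt)
    neg_injective.injOn]
  refine setLIntegral_congr_fun measurableSet_Ioi fun x hx => ?_
  simp [gaussianPDF, gaussianPDFReal]

instance isProbabilityMeasure_chiSquaredMeasure (k : ℕ) :
    IsProbabilityMeasure (chiSquaredMeasure k) :=
  Measure.isProbabilityMeasure_map (Measurable.aemeasurable (by fun_prop))

lemma chiSquaredMeasure_zero : chiSquaredMeasure 0 = Measure.dirac 0 := by
  simp [chiSquaredMeasure]

lemma chiSquaredMeasure_succ (k : ℕ) :
    chiSquaredMeasure (k + 1) =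
      (((gaussianReal 0 1).map fun x => x ^ 2).prod (chiSquaredMeasure k)).map
        fun w => w.1 + w.2 := by
  have hmp := (measurePreserving_piFinSuccAbove (fun _ : Fin (k + 1) => gaussianReal 0 1) 0).map_eq
  rw [chiSquaredMeasure, chiSquaredMeasure, Measure.map_prod_map _ _ (by fun_prop) (by fun_prop),
    ← hmp, Measure.map_map (by fun_prop) (by fun_prop), Measure.map_map (by fun_prop) (by fun_prop)]
  congr 1
  ext g
  simp [Fin.sum_univ_succ, MeasurableEquiv.piFinSuccAbove, Fin.tail]

/-- The chi-squared distribution with `k` degrees of freedom is a gamma distribution. -/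
lemma chiSquaredMeasure_eq_gammaMeasure {k : ℕ} (hk : 1 ≤ k) :
    chiSquaredMeasure k = gammaMeasure (k / 2) (1 / 2) := by
  induction k, hk using Nat.le_induction with
  | base =>
    rw [chiSquaredMeasure_succ, chiSquaredMeasure_zero, Measure.prod_dirac,
      Measure.map_map (by fun_prop) (by fun_prop), map_sq_gaussianReal]
    simp [Function.comp_def]
  | succ k hk ih =>
    have : 0 < (k : ℝ) / 2 := by positivity
    rw [chiSquaredMeasure_succ, ih, map_sq_gaussianReal,
      map_add_prod_gammaMeasure (by norm_num) this (by norm_num)]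
    congr 1
    push_cast
    ring

/-- If `X` and `Y` are independent chi-squared random variables, then `X / (X + Y)` has a beta
distribution. -/
lemma map_div_add_prod_chiSquaredMeasure {k l : ℕ} (hk : 1 ≤ k) (hl : 1 ≤ l) :
    ((chiSquaredMeasure k).prod (chiSquaredMeasure l)).map (fun w => w.1 / (w.1 + w.2)) =
      betaMeasure (k / 2) (l / 2) := by
  rw [chiSquaredMeasure_eq_gammaMeasure hk, chiSquaredMeasure_eq_gammaMeasure hl]
  exact map_div_add_prod_gammaMeasure (by positivity) (by positivity) (by norm_num)

/-! ### Projections and residuals -/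

section Gaussian

variable {E : Type*} [NormedAddCommGroup E] [InnerProductSpace ℝ E]

lemma mem_sup_span_range_iff {κ : Type*} [Fintype κ] (U : Submodule ℝ E) (z : κ → E) (v : E) :
    v ∈ U ⊔ Submodule.span ℝ (Set.range z) ↔ ∃ u ∈ U, ∃ c : κ → ℝ, u + ∑ i, c i • z i = v := by
  simp only [Submodule.mem_sup, Submodule.mem_span_range_iff_exists_fun]
  constructor
  · rintro ⟨u, hu, _, ⟨c, rfl⟩, rfl⟩
    exact ⟨u, hu, c, rfl⟩
  · rintro ⟨u, hu, c, rfl⟩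
    exact ⟨u, hu, _, ⟨c, rfl⟩, rfl⟩

lemma map_sup_span_range {κ : Type*} (U : Submodule ℝ E) (R : E ≃ₗᵢ[ℝ] E)
    (hR : ∀ u ∈ U, R u = u) (z : κ → E) :
    (U ⊔ Submodule.span ℝ (Set.range z)).map (R.toLinearEquiv : E →ₗ[ℝ] E) =
      U ⊔ Submodule.span ℝ (Set.range fun i => R (z i)) := by
  have hU : U.map (R.toLinearEquiv : E →ₗ[ℝ] E) = U := by
    ext v
    constructor
    · rintro ⟨u, hu, rfl⟩
      simpa [hR u hu] using hu
    · exact fun hv => ⟨v, hv, hR v hv⟩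
  rw [Submodule.map_sup, hU, Submodule.map_span, ← Set.range_comp]
  rfl

variable [FiniteDimensional ℝ E]

/-- The projection minimises the distance to `W`. The existential form makes it possible to see how
the residual depends on `W`. -/
lemma norm_sub_starProjection_lt_iff (W : Submodule ℝ E) (v : E) (a : ℝ) :
    ‖v - W.starProjection v‖ < a ↔ ∃ u ∈ W, ‖v - u‖ < a := by
  constructor
  · exact fun h => ⟨_, W.starProjection_apply_mem v, h⟩
  · rintro ⟨u, hu, h⟩
    refine lt_of_le_of_lt ?_ h
    rw [Submodule.starProjection_minimal]
    exact ciInf_le ⟨0, by rintro _ ⟨w, rfl⟩; exact norm_nonneg _⟩ (⟨u, hu⟩ : W)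

lemma sub_starProjection_eq_zero_iff (W : Submodule ℝ E) (v : E) :
    ‖v - W.starProjection v‖ = 0 ↔ v ∈ W := by
  rw [norm_eq_zero, sub_eq_zero, eq_comm, Submodule.starProjection_eq_self_iff]

/-- For `U ≤ W`, the squared residual with respect to `U` splits into the squared residual with
respect to `W` and the squared norm of the projection onto the part of `W` orthogonal to `U`. -/
lemma norm_sq_sub_starProjection_eq_add {U W : Submodule ℝ E} (hUW : U ≤ W) (g : E) :
    ‖g - U.starProjection g‖ ^ 2 =
      ‖Wᗮ.starProjection g‖ ^ 2 + ‖(Uᗮ ⊓ W).starProjection g‖ ^ 2 := by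
  have hU := U.starProjection_apply_mem g
  have hW := W.starProjection_apply_mem g
  have hgU := U.sub_starProjection_mem_orthogonal g
  have hgW := W.sub_starProjection_mem_orthogonal g
  have hproj : (Uᗮ ⊓ W).starProjection g = W.starProjection g - U.starProjection g := by
    refine Submodule.eq_starProjection_of_mem_orthogonal ⟨?_, W.sub_mem hW (hUW hU)⟩ ?_
    · have := Uᗮ.sub_mem hgU (Submodule.orthogonal_le hUW hgW)
      simpa using this
    · have h1 : g - W.starProjection g ∈ (Uᗮ ⊓ W)ᗮ := Submodule.orthogonal_le inf_le_right hgW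
      have h2 : U.starProjection g ∈ (Uᗮ ⊓ W)ᗮ :=
        Submodule.orthogonal_le inf_le_left (U.le_orthogonal_orthogonal hU)
      have := (Uᗮ ⊓ W)ᗮ.add_mem h1 h2
      rwa [sub_sub_eq_add_sub, ← sub_add_eq_add_sub]
  rw [hproj, Submodule.starProjection_orthogonal_val]
  have hsplit : g - U.starProjection g =
      (g - W.starProjection g) + (W.starProjection g - U.starProjection g) := by abel
  have hinner : inner ℝ (g - W.starProjection g) (W.starProjection g - U.starProjection g) = 0 :=
    W.starProjection_inner_eq_zero g _ (W.sub_mem hW (hUW hU))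
  rw [hsplit, sq, sq, sq, norm_add_sq_eq_norm_sq_add_norm_sq_real hinner]

lemma sub_starProjection_sub_of_mem {W : Submodule ℝ E} {u : E} (hu : u ∈ W) (v : E) :
    (v - u) - W.starProjection (v - u) = v - W.starProjection v := by
  rw [map_sub, Submodule.starProjection_eq_self_iff.2 hu]
  abel

lemma norm_sub_starProjection_map {κ : Type*} (U : Submodule ℝ E) (R : E ≃ₗᵢ[ℝ] E)
    (hR : ∀ u ∈ U, R u = u) (z : κ → E) (v : E) :
    ‖R v - (U ⊔ Submodule.span ℝ (Set.range fun i => R (z i))).starProjection (R v)‖ =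
      ‖v - (U ⊔ Submodule.span ℝ (Set.range z)).starProjection v‖ := by
  simp_rw [← map_sup_span_range U R hR z]
  rw [Submodule.starProjection_map_apply, R.symm_apply_apply, ← map_sub, R.norm_map]

lemma norm_sq_starProjection_eq_sum {ι : Type*} [Fintype ι] (A : Submodule ℝ E)
    (b : OrthonormalBasis ι ℝ A) (g : E) :
    ‖A.starProjection g‖ ^ 2 = ∑ i, inner ℝ (b i : E) g ^ 2 := by
  rw [Submodule.starProjection_apply, ← Submodule.coe_norm, ← b.sum_sq_norm_inner_right]
  refine Finset.sum_congr rfl fun i _ => ?_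
  rw [Real.norm_eq_abs, sq_abs, Submodule.inner_orthogonalProjectionOnto_eq_of_mem_left]

/-! ### Measurability and Gaussian vectors -/

variable [MeasurableSpace E] [BorelSpace E]

/-- The residual norm can jump where the rank of `z` drops, but it is upper semicontinuous: a
distance is an infimum, here over coefficients, of continuous functions, so its strict sublevel sets
are unions of open sets. -/
lemma measurable_norm_sub_starProjection_sup_span {κ : Type*} [Fintype κ] (U : Submodule ℝ E) :
    Measurable fun w : E × (κ → E) =>
      ‖w.1 - (U ⊔ Submodule.span ℝ (Set.range w.2)).starProjection w.1‖ := by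
  refine measurable_of_Iio fun a => IsOpen.measurableSet ?_
  have : (fun w : E × (κ → E) =>
      ‖w.1 - (U ⊔ Submodule.span ℝ (Set.range w.2)).starProjection w.1‖) ⁻¹' Set.Iio a =
      ⋃ u : U, ⋃ c : κ → ℝ, {w : E × (κ → E) | ‖w.1 - (u + ∑ i, c i • w.2 i)‖ < a} := by
    ext w
    simp only [Set.mem_preimage, Set.mem_Iio, norm_sub_starProjection_lt_iff,
      mem_sup_span_range_iff, Set.mem_iUnion, Set.mem_ofPred_eq]
    constructor
    · rintro ⟨_, ⟨u, hu, c, rfl⟩, h⟩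
      exact ⟨⟨u, hu⟩, c, h⟩
    · rintro ⟨⟨u, hu⟩, c, h⟩
      exact ⟨_, ⟨u, hu, c, rfl⟩, h⟩
  rw [this]
  exact isOpen_iUnion fun u => isOpen_iUnion fun c => isOpen_lt (by fun_prop) (by fun_prop)

lemma measurableSet_mem_sup_span {κ : Type*} [Fintype κ] (U : Submodule ℝ E) :
    MeasurableSet {w : E × (κ → E) | w.1 ∈ U ⊔ Submodule.span ℝ (Set.range w.2)} := by
  have := measurable_norm_sub_starProjection_sup_span (κ := κ) U (measurableSet_singleton 0)
  convert this using 1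
  ext w
  simp only [Set.mem_ofPred_eq, Set.mem_preimage, Set.mem_singleton_iff,
    sub_starProjection_eq_zero_iff]

/-- A proper subspace is a null set for the standard Gaussian measure. -/
lemma stdGaussian_submodule_eq_zero {W : Submodule ℝ E} (hW : W ≠ ⊤) :
    stdGaussian E (W : Set E) = 0 := by
  -- The inner product with a nonzero `a` orthogonal to `W` is a nondegenerate Gaussian, hence
  -- atomless, but vanishes on `W`.
  obtain ⟨a, haW, ha0⟩ := Submodule.exists_mem_ne_zero_of_ne_bot
    (mt Submodule.orthogonal_eq_bot_iff.1 hW)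
  have hmap := IsGaussian.map_eq_gaussianReal (μ := stdGaussian E) (innerSL ℝ a)
  have hnull : (stdGaussian E).map (innerSL ℝ a) {0} = 0 := by
    rw [hmap]
    have : NullSingletonClass (gaussianReal (∫ x, innerSL ℝ a x ∂stdGaussian E)
        Var[innerSL ℝ a; stdGaussian E].toNNReal) := by
      refine nullSingletonClass_gaussianReal ?_
      rw [variance_dual_stdGaussian, innerSL_apply_norm]
      simpa using ha0
    exact measure_singleton 0
  rw [Measure.map_apply (by fun_prop) (measurableSet_singleton 0)] at hnull
  refine measure_mono_null (fun w hw => ?_) hnull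
  exact (Submodule.mem_orthogonal' W a).1 haW w hw

/-- The coordinates of a standard Gaussian vector along an orthonormal family are independent
standard Gaussian random variables. -/
lemma map_inner_orthonormal_stdGaussian {ι : Type*} [Fintype ι] {v : ι → E}
    (hv : Orthonormal ℝ v) :
    (stdGaussian E).map (fun g i => inner ℝ (v i) g) =
      Measure.pi fun _ : ι => gaussianReal 0 1 := by
  have hm : Measurable fun (g : E) (i : ι) => inner ℝ (v i) g := by fun_prop
  have hinj : Function.Injective (Measure.map (WithLp.toLp 2 : (ι → ℝ) → EuclideanSpace ℝ ι)) :=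
    (MeasurableEquiv.toLp 2 (ι → ℝ)).map_measurableEquiv_injective
  apply hinj
  rw [map_pi_eq_stdGaussian, Measure.map_map (by fun_prop) hm]
  have : IsProbabilityMeasure ((stdGaussian E).map
      ((WithLp.toLp 2 : (ι → ℝ) → EuclideanSpace ℝ ι) ∘ fun g i => inner ℝ (v i) g)) :=
    Measure.isProbabilityMeasure_map (by fun_prop)
  refine Measure.ext_of_charFun ?_
  ext t
  -- The characteristic function of the coordinates at `t` is that of the Gaussian vector at `∑ i, t
  -- i • v i`, and depends only on the norm.
  have hnorm : ‖∑ i, t i • v i‖ = ‖t‖ := by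
    rw [← sq_eq_sq₀ (norm_nonneg _) (norm_nonneg _), EuclideanSpace.real_norm_sq_eq,
      ← real_inner_self_eq_norm_sq, hv.inner_sum]
    simp [sq]
  rw [charFun_stdGaussian, ← hnorm, ← charFun_stdGaussian, charFun_apply, charFun_apply,
    integral_map (by fun_prop) (by fun_prop)]
  congr 1
  ext g
  simp [PiLp.inner_apply, inner_sum, inner_smul_right, real_inner_comm]

/-- The squared norms of the projections of a standard Gaussian vector onto orthogonal subspaces are
independent chi-squared random variables. -/
lemma map_norm_sq_starProjection_stdGaussian {A B : Submodule ℝ E} (hAB : A ⟂ B) :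
    (stdGaussian E).map (fun g => (‖A.starProjection g‖ ^ 2, ‖B.starProjection g‖ ^ 2)) =
      (chiSquaredMeasure (Module.finrank ℝ A)).prod (chiSquaredMeasure (Module.finrank ℝ B)) := by
  let a := stdOrthonormalBasis ℝ A
  let b := stdOrthonormalBasis ℝ B
  let v : Fin (Module.finrank ℝ A) ⊕ Fin (Module.finrank ℝ B) → E :=
    Sum.elim (fun i => (a i : E)) (fun j => (b j : E))
  have hv : Orthonormal ℝ v := by
    have ha := a.orthonormal
    have hb := b.orthonormal
    rw [orthonormal_iff_ite] at ha hb ⊢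
    rintro (i | i) (j | j)
    · simpa [v] using ha i j
    · simpa [v] using hAB.inner_eq (a i).2 (b j).2
    · simpa [v] using hAB.symm.inner_eq (b i).2 (a j).2
    · simpa [v] using hb i j
  have hpi := map_inner_orthonormal_stdGaussian hv
  have hsum := (measurePreserving_sumPiEquivProdPi
    (fun _ : Fin (Module.finrank ℝ A) ⊕ Fin (Module.finrank ℝ B) => gaussianReal 0 1)).map_eq
  rw [chiSquaredMeasure, chiSquaredMeasure, Measure.map_prod_map _ _ (by fun_prop) (by fun_prop),
    ← hsum, ← hpi, Measure.map_map (by fun_prop) (by fun_prop),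
    Measure.map_map (by fun_prop) (by fun_prop)]
  congr 1
  ext g
  · exact norm_sq_starProjection_eq_sum A a g
  · exact norm_sq_starProjection_eq_sum B b g

/-- For nested subspaces `U < W < ⊤`, the ratio of the squared residuals of a standard Gaussian
vector has a beta distribution. -/
lemma map_residual_ratio_stdGaussian {U W : Submodule ℝ E} {k l : ℕ} (hUW : U ≤ W) (hk : 1 ≤ k)
    (hl : 1 ≤ l) (hWk : Module.finrank ℝ W = Module.finrank ℝ U + k)
    (hWl : Module.finrank ℝ W + l = Module.finrank ℝ E) :
    (stdGaussian E).map
        (fun g => ‖g - W.starProjection g‖ ^ 2 / ‖g - U.starProjection g‖ ^ 2) =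
      betaMeasure (l / 2) (k / 2) := by
  have hA : Module.finrank ℝ Wᗮ = l := by
    have := W.finrank_add_finrank_orthogonal
    omega
  have hB : Module.finrank ℝ ↥(Uᗮ ⊓ W) = k := by
    have := Submodule.finrank_add_inf_finrank_orthogonal hUW
    omega
  have hort : Wᗮ ⟂ (Uᗮ ⊓ W) :=
    (Submodule.isOrtho_orthogonal_left W).mono_right inf_le_right
  have h := map_norm_sq_starProjection_stdGaussian hort
  rw [hA, hB] at h
  rw [← map_div_add_prod_chiSquaredMeasure hl hk, ← h,
    Measure.map_map (by fun_prop) (by fun_prop)]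
  congr 1
  ext g
  simp only [Function.comp_apply]
  rw [norm_sq_sub_starProjection_eq_add hUW, Submodule.starProjection_orthogonal_val]

/-- Finitely many independent standard Gaussian vectors are almost surely linearly independent
modulo a fixed subspace, as long as the dimensions allow it. -/
lemma ae_finrank_sup_span_stdGaussian {κ : Type*} [Fintype κ] (U : Submodule ℝ E)
    (hU : Module.finrank ℝ U + Fintype.card κ ≤ Module.finrank ℝ E) :
    ∀ᵐ z ∂(Measure.pi fun _ : κ => stdGaussian E),
      Module.finrank ℝ ↥(U ⊔ Submodule.span ℝ (Set.range z)) =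
        Module.finrank ℝ U + Fintype.card κ := by
  classical
  suffices h : ∀ s : Finset κ, ∀ᵐ z ∂(Measure.pi fun _ : κ => stdGaussian E),
      Module.finrank ℝ ↥(U ⊔ Submodule.span ℝ (Set.range fun i : s => z i)) =
        Module.finrank ℝ U + s.card by
    filter_upwards [h Finset.univ] with z hz
    have : Set.range (fun i : (Finset.univ : Finset κ) => z i) = Set.range z := by
      ext v; simp
    rwa [this] at hz
  intro s
  induction s using Finset.induction_on with
  | empty =>
    refine ae_of_all _ fun z => ?_
    rw [Set.range_eq_empty, Submodule.span_empty, sup_bot_eq, Finset.card_empty, add_zero]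
  | insert j s hj ih =>
    have hcard : s.card < Fintype.card κ := Finset.card_lt_univ_of_notMem hj
    have hind : iIndepFun (fun (i : κ) (z : κ → E) => z i)
        (Measure.pi fun _ : κ => stdGaussian E) :=
      iIndepFun_pi (X := fun _ => id) fun _ => aemeasurable_id
    have hpair := hind.indepFun_finset {j} s (by simpa using hj) (fun i => by fun_prop)
    have hmj : Measurable fun z : κ → E => z j := measurable_pi_apply j
    have hms : Measurable fun (z : κ → E) (i : s) => z i := by fun_prop
    have hev : Measurable fun f : ({j} : Finset κ) → E => f ⟨j, Finset.mem_singleton_self j⟩ :=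
      measurable_pi_apply _
    have hpair' : IndepFun (fun z : κ → E => z j) (fun z (i : s) => z i)
        (Measure.pi fun _ : κ => stdGaussian E) :=
      hpair.comp hev measurable_id
    rw [indepFun_iff_map_prod_eq_prod_map_map hmj.aemeasurable hms.aemeasurable,
      (measurePreserving_eval (fun _ : κ => stdGaussian E) j).map_eq] at hpair'
    set ρ := (Measure.pi fun _ : κ => stdGaussian E).map (fun z (i : s) => z i) with hρ
    have : IsProbabilityMeasure ρ := Measure.isProbabilityMeasure_map hms.aemeasurable
    have hS := measurableSet_mem_sup_span (κ := s) U
    have hnull : (Measure.pi fun _ : κ => stdGaussian E)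
        {z | z j ∈ U ⊔ Submodule.span ℝ (Set.range fun i : s => z i)} = 0 := by
      have h0 : ((stdGaussian E).prod ρ)
          {w : E × (s → E) | w.1 ∈ U ⊔ Submodule.span ℝ (Set.range w.2)} = 0 := by
        -- With the earlier vectors frozen, their span with `U` is proper by the dimension count, so
        -- the new independent vector almost surely avoids it.
        rw [Measure.prod_apply_symm hS]
        refine (lintegral_congr fun w => ?_).trans lintegral_zero
        refine stdGaussian_submodule_eq_zero
          (W := U ⊔ Submodule.span ℝ (Set.range w)) fun htop => ?_
        have h1 := Submodule.finrank_add_le_finrank_add_finrank U (Submodule.span ℝ (Set.range w))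
        have h2 := finrank_range_le_card (R := ℝ) w
        rw [htop, finrank_top] at h1
        rw [Set.finrank, Fintype.card_coe] at h2
        omega
      rw [← hpair', Measure.map_apply (hmj.prodMk hms) hS] at h0
      exact h0
    filter_upwards [ih, measure_eq_zero_iff_ae_notMem.1 hnull] with z hz hzj
    have hrange : Submodule.span ℝ (Set.range fun i : (insert j s : Finset κ) => z i) =
        Submodule.span ℝ (Set.range fun i : s => z i) ⊔ Submodule.span ℝ {z j} := by
      rw [← Submodule.span_union]
      congr 1
      ext v
      simp [eq_comm]
    rw [hrange, ← sup_assoc, Submodule.finrank_sup_span_singleton hzj, hz,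
      Finset.card_insert_of_notMem hj]
    ring

/-! ### Trading the fixed response for a Gaussian one -/

/-- The law of the residual ratio for Gaussian regressors does not depend on the response. -/
lemma map_residual_ratio_pi_stdGaussian_congr {κ : Type*} [Fintype κ] (U : Submodule ℝ E)
    {y y' : E} (hy : y ∉ U) (hy' : y' ∉ U) :
    (Measure.pi fun _ : κ => stdGaussian E).map (fun z =>
        ‖y - (U ⊔ Submodule.span ℝ (Set.range z)).starProjection y‖ ^ 2 /
          ‖y - U.starProjection y‖ ^ 2) =
      (Measure.pi fun _ : κ => stdGaussian E).map (fun z =>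
        ‖y' - (U ⊔ Submodule.span ℝ (Set.range z)).starProjection y'‖ ^ 2 /
          ‖y' - U.starProjection y'‖ ^ 2) := by
  have hmeas (v : E) : Measurable fun z : κ → E =>
      ‖v - (U ⊔ Submodule.span ℝ (Set.range z)).starProjection v‖ :=
    (measurable_norm_sub_starProjection_sup_span U).comp
      (measurable_const.prodMk measurable_id)
  set r := y - U.starProjection y with hr
  set r' := y' - U.starProjection y' with hr'
  have hrU : r ∈ Uᗮ := U.sub_starProjection_mem_orthogonal y
  have hrU' : r' ∈ Uᗮ := U.sub_starProjection_mem_orthogonal y'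
  have hr0 : ‖r‖ ≠ 0 := mt (sub_starProjection_eq_zero_iff U y).1 hy
  have hr0' : ‖r'‖ ≠ 0 := mt (sub_starProjection_eq_zero_iff U y').1 hy'
  set c : ℝ := ‖r'‖ / ‖r‖ with hc
  have hc0 : c ≠ 0 := div_ne_zero hr0' hr0
  have hnorm : ‖c • r‖ = ‖r'‖ := by
    rw [norm_smul, hc, norm_div, norm_norm, norm_norm]
    field_simp
  -- The scale `c` gives both residuals the same norm, so this reflection sends `c • r` to `r'`. It
  -- fixes `U` because both lie in `Uᗮ`; the factor `c` cancels in the ratio.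
  set R := (Submodule.span ℝ {c • r - r'})ᗮ.reflection with hR
  have hRr : R (c • r) = r' := Submodule.reflection_sub hnorm
  have hRU : ∀ u ∈ U, R u = u := by
    intro u hu
    refine Submodule.reflection_mem_subspace_eq_self ?_
    rw [Submodule.mem_orthogonal_singleton_iff_inner_left]
    exact (Submodule.mem_orthogonal U _).1 (Uᗮ.sub_mem (Uᗮ.smul_mem c hrU) hrU') u hu
  have hmap : (Measure.pi fun _ : κ => stdGaussian E).map (fun z i => R (z i)) =
      Measure.pi fun _ : κ => stdGaussian E := by
    rw [Measure.pi_map_pi fun _ => by fun_prop]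
    simp_rw [stdGaussian_map]
  have hres (v : E) (z : κ → E) :
      v - (U ⊔ Submodule.span ℝ (Set.range z)).starProjection v =
        (v - U.starProjection v) -
          (U ⊔ Submodule.span ℝ (Set.range z)).starProjection (v - U.starProjection v) :=
    (sub_starProjection_sub_of_mem (Submodule.mem_sup_left (U.starProjection_apply_mem v)) v).symm
  conv_rhs => rw [← hmap]
  rw [Measure.map_map (((hmeas y').pow_const 2).div_const _) (by fun_prop)]
  congr 1
  ext z
  simp only [Function.comp_apply]
  rw [hres y, hres y', ← hr, ← hr', ← hRr, norm_sub_starProjection_map U R hRU, R.norm_map,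
    map_smul, ← smul_sub, norm_smul, norm_smul, mul_pow, mul_pow,
    mul_div_mul_left _ _ (pow_ne_zero 2 (norm_ne_zero_iff.2 hc0))]

/-- The residual ratio for a fixed response and Gaussian regressors has a beta distribution. -/
lemma map_residual_ratio_pi_stdGaussian {κ : Type*} [Fintype κ] (U : Submodule ℝ E) {y : E}
    (hy : y ∉ U) {l : ℕ} (hκ : 1 ≤ Fintype.card κ) (hl : 1 ≤ l)
    (hdim : Module.finrank ℝ U + Fintype.card κ + l = Module.finrank ℝ E) :
    (Measure.pi fun _ : κ => stdGaussian E).map (fun z =>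
        ‖y - (U ⊔ Submodule.span ℝ (Set.range z)).starProjection y‖ ^ 2 /
          ‖y - U.starProjection y‖ ^ 2) =
      betaMeasure (l / 2) ((Fintype.card κ : ℝ) / 2) := by
  have hF : Measurable fun w : E × (κ → E) =>
      ‖w.1 - (U ⊔ Submodule.span ℝ (Set.range w.2)).starProjection w.1‖ ^ 2 /
          ‖w.1 - U.starProjection w.1‖ ^ 2 :=
    ((measurable_norm_sub_starProjection_sup_span U).pow_const 2).div (by fun_prop)
  have hUtop : U ≠ ⊤ := fun h => hy (h ▸ Submodule.mem_top)
  have hae : ∀ᵐ g ∂stdGaussian E, g ∉ U :=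
    measure_eq_zero_iff_ae_notMem.1 (stdGaussian_submodule_eq_zero hUtop)
  ext S hS
  -- One product probability is computed in both orders: here the inner integral over `z` is almost
  -- surely constant in `g`, and in `h2` the inner integral over `g` is almost surely constant in
  -- `z`.
  have h1 : ((stdGaussian E).prod (Measure.pi fun _ : κ => stdGaussian E)) ((fun w =>
      ‖w.1 - (U ⊔ Submodule.span ℝ (Set.range w.2)).starProjection w.1‖ ^ 2 /
          ‖w.1 - U.starProjection w.1‖ ^ 2) ⁻¹' S) =
      (Measure.pi fun _ : κ => stdGaussian E).map (fun z =>
        ‖y - (U ⊔ Submodule.span ℝ (Set.range z)).starProjection y‖ ^ 2 /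
          ‖y - U.starProjection y‖ ^ 2) S := by
    rw [Measure.prod_apply (hF hS), lintegral_congr_ae (g := fun _ => _) (hae.mono fun g hg => ?_),
      lintegral_const, measure_univ, mul_one]
    simp only
    rw [map_residual_ratio_pi_stdGaussian_congr U hy hg]
    exact (Measure.map_apply (hF.comp (measurable_const.prodMk measurable_id)) hS).symm
  have h2 : ((stdGaussian E).prod (Measure.pi fun _ : κ => stdGaussian E)) ((fun w =>
      ‖w.1 - (U ⊔ Submodule.span ℝ (Set.range w.2)).starProjection w.1‖ ^ 2 /
          ‖w.1 - U.starProjection w.1‖ ^ 2) ⁻¹' S) =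
      betaMeasure (l / 2) ((Fintype.card κ : ℝ) / 2) S := by
    rw [Measure.prod_apply_symm (hF hS), lintegral_congr_ae (g := fun _ => _)
      ((ae_finrank_sup_span_stdGaussian (κ := κ) U (by omega)).mono fun z hz => ?_),
      lintegral_const, measure_univ, mul_one]
    simp only
    rw [← map_residual_ratio_stdGaussian (le_sup_left : U ≤ _) hκ hl hz (by omega)]
    exact (Measure.map_apply (hF.comp (measurable_id.prodMk measurable_const)) hS).symm
  rw [← h1, h2]

end Gaussian

/-! ### Fisher tails as beta probabilities -/

instance isProbabilityMeasure_fisherMeasure (k l : ℕ) :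
    IsProbabilityMeasure (fisherMeasure k l) :=
  Measure.isProbabilityMeasure_map (by fun_prop)

lemma ae_pos_chiSquaredMeasure {k : ℕ} (hk : 1 ≤ k) : ∀ᵐ x ∂chiSquaredMeasure k, 0 < x := by
  have hzero : gammaMeasure (k / 2) (1 / 2) (Set.Iic 0) = 0 := by
    rw [gammaMeasure, withDensity_apply _ measurableSet_Iic, setLIntegral_congr Iio_ae_eq_Iic.symm]
    exact lintegral_gammaPDF_of_nonpos le_rfl
  rw [chiSquaredMeasure_eq_gammaMeasure hk]
  filter_upwards [measure_eq_zero_iff_ae_notMem.1 hzero] with x hx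
  simpa using hx

/-- The upper tail of Fisher's F distribution in terms of the beta distribution. -/
lemma one_sub_cdf_fisherMeasure {k l : ℕ} (hk : 1 ≤ k) (hl : 1 ≤ l) {ρ : ℝ} (hρ : 0 < ρ) :
    1 - cdf (fisherMeasure k l) (((1 - ρ) / k) / (ρ / l)) =
      cdf (betaMeasure (l / 2) (k / 2)) ρ := by
  have hk0 : (0 : ℝ) < k := by exact_mod_cast hk
  have hl0 : (0 : ℝ) < l := by exact_mod_cast hl
  have := isProbabilityMeasureBeta (α := (l : ℝ) / 2) (β := (k : ℝ) / 2) (by positivity)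
    (by positivity)
  -- The complement of the Fisher event is strict while `cdf` is not; the beta law has a density, so
  -- the endpoint does not matter.
  have hatom : betaMeasure ((l : ℝ) / 2) (k / 2) (Set.Iic ρ) =
      betaMeasure ((l : ℝ) / 2) (k / 2) (Set.Iio ρ) := by
    rw [betaMeasure, withDensity_apply _ measurableSet_Iic, withDensity_apply _ measurableSet_Iio,
      setLIntegral_congr Iio_ae_eq_Iic]
  rw [cdf_eq_real, cdf_eq_real, ← probReal_compl_eq_one_sub measurableSet_Iic, Set.compl_Iic,
    measureReal_def, measureReal_def, hatom, ← map_div_add_prod_chiSquaredMeasure hl hk,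
    fisherMeasure, Measure.map_apply (by fun_prop) measurableSet_Ioi,
    Measure.map_apply (by fun_prop) measurableSet_Iio, ← Measure.prod_swap,
    Measure.map_apply measurable_swap (measurableSet_Ioi.preimage (by fun_prop))]
  congr 1
  have hpos : ∀ᵐ w ∂(chiSquaredMeasure l).prod (chiSquaredMeasure k), 0 < w.1 ∧ 0 < w.2 :=
    (Measure.quasiMeasurePreserving_fst.ae (ae_pos_chiSquaredMeasure hl)).and
      (Measure.quasiMeasurePreserving_snd.ae (ae_pos_chiSquaredMeasure hk))
  refine measure_congr (hpos.mono fun w hw => propext ?_)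
  obtain ⟨h1, h2⟩ := hw
  change (1 - ρ) / k / (ρ / l) < w.2 / k / (w.1 / l) ↔ w.1 / (w.1 + w.2) < ρ
  rw [div_div_div_eq, div_div_div_eq, div_lt_div_iff₀ (by positivity) (by positivity),
    div_lt_iff₀ (by positivity)]
  have e : w.2 * l * (k * ρ) - (1 - ρ) * l * (k * w.1) =
      (l * k) * (ρ * (w.1 + w.2) - w.1) := by ring
  rw [← sub_pos, e, mul_pos_iff_of_pos_left (by positivity), sub_pos]

/-! ### Application to the regression model -/

section Regression

variable {n : ℕ} {ι : Type*}

lemma linearIndependent_responseAndRegressors_iff {y : EuclideanSpace ℝ (Fin n)}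
    {x : ι → EuclideanSpace ℝ (Fin n)} {S : Finset ι} :
    LinearIndependent ℝ (responseAndRegressors y x S) ↔
      LinearIndepOn ℝ x (S : Set ι) ∧ y ∉ regressorSpan x S := by
  rw [linearIndependent_option, regressorSpan, Set.image_eq_range]
  rfl

lemma finrank_regressorSpan {x : ι → EuclideanSpace ℝ (Fin n)} {S : Finset ι}
    (h : LinearIndepOn ℝ x (S : Set ι)) : Module.finrank ℝ (regressorSpan x S) = S.card := by
  rw [regressorSpan, Set.image_eq_range]
  exact (finrank_span_eq_card h).trans (Fintype.card_coe S)

lemma residualSS_pos {y : EuclideanSpace ℝ (Fin n)} {x : ι → EuclideanSpace ℝ (Fin n)}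
    {S : Finset ι} (h : y ∉ regressorSpan x S) : 0 < residualSS y x S := by
  have h0 : ‖y - fittedVector y x S‖ ≠ 0 := mt (sub_starProjection_eq_zero_iff _ y).1 h
  exact pow_pos (lt_of_le_of_ne (norm_nonneg _) h0.symm) 2

lemma regressorSpan_replaceRegressors [DecidableEq ι] {N Nstar : Finset ι} (hN : N ⊆ Nstar)
    (x z : ι → EuclideanSpace ℝ (Fin n)) :
    regressorSpan (replaceRegressors N x z) Nstar =
      regressorSpan x N ⊔ Submodule.span ℝ (Set.range fun ν : ↥(Nstar \ N) => z ν) := by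
  have hcoe : (Nstar : Set ι) = (N : Set ι) ∪ ((Nstar \ N : Finset ι) : Set ι) := by
    rw [← Finset.coe_union, Finset.union_sdiff_of_subset hN]
  have h1 : replaceRegressors N x z '' N = x '' N :=
    Set.image_congr fun ν hν => if_pos hν
  have h2 : replaceRegressors N x z '' ((Nstar \ N : Finset ι) : Set ι) =
      Set.range fun ν : ↥(Nstar \ N) => z ν := by
    have : replaceRegressors N x z '' ((Nstar \ N : Finset ι) : Set ι) =
        z '' ((Nstar \ N : Finset ι) : Set ι) :=
      Set.image_congr fun ν hν => if_neg (Finset.mem_sdiff.1 hν).2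
    rw [this, Set.image_eq_range]
    rfl
  rw [regressorSpan, hcoe, Set.image_union, Submodule.span_union, h1, h2, regressorSpan]

end Regression

theorem theorem1 {n : ℕ} {ι : Type*} [DecidableEq ι] (N Nstar : Finset ι)
    (hN : N ⊂ Nstar) (hn : Nstar.card < n)
    (y : EuclideanSpace ℝ (Fin n)) (x : ι → EuclideanSpace ℝ (Fin n))
    (hlin : LinearIndependent ℝ (responseAndRegressors y x N))
    {Ω : Type*} [MeasurableSpace Ω] (P : Measure Ω) [IsProbabilityMeasure P]
    (z : ι → Ω → EuclideanSpace ℝ (Fin n))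
    (hz : ∀ ν ∈ Nstar \ N, HasLaw (z ν) (stdGaussian (EuclideanSpace ℝ (Fin n))) P)
    (hindep : iIndepFun (fun ν : ↥(Nstar \ N) => z ν) P) :
    HasLaw
      (fun ω => residualSS y (replaceRegressors N x (fun ν => z ν ω)) Nstar / residualSS y x N)
      (betaMeasure (((n : ℝ) - Nstar.card) / 2) (((Nstar.card : ℝ) - N.card) / 2)) P ∧
    (LinearIndependent ℝ (responseAndRegressors y x Nstar) →
      fTestPValue y x N Nstar =
        cdf (betaMeasure (((n : ℝ) - Nstar.card) / 2) (((Nstar.card : ℝ) - N.card) / 2))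
          (residualSS y x Nstar / residualSS y x N) ∧
      P.real {ω | residualSS y (replaceRegressors N x (fun ν => z ν ω)) Nstar / residualSS y x N
          ≤ residualSS y x Nstar / residualSS y x N} = fTestPValue y x N Nstar ∧
      P.real {ω | residualSS y x N - residualSS y x Nstar
          ≤ residualSS y x N - residualSS y (replaceRegressors N x (fun ν => z ν ω)) Nstar} =
        fTestPValue y x N Nstar) := by
  obtain ⟨hlinN, hyN⟩ := linearIndependent_responseAndRegressors_iff.1 hlin
  have hSSN := residualSS_pos hyN
  have hsub := hN.subset
  have hlt := Finset.card_lt_card hN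
  have hcard : Fintype.card ↥(Nstar \ N) = Nstar.card - N.card := by
    rw [Fintype.card_coe, Finset.card_sdiff_of_subset hsub]
  have hl : ((n - Nstar.card : ℕ) : ℝ) = (n : ℝ) - Nstar.card := Nat.cast_sub hn.le
  have hk : ((Nstar.card - N.card : ℕ) : ℝ) = (Nstar.card : ℝ) - N.card := Nat.cast_sub hlt.le
  have hlaw : HasLaw
      (fun ω => residualSS y (replaceRegressors N x (fun ν => z ν ω)) Nstar / residualSS y x N)
      (betaMeasure (((n : ℝ) - Nstar.card) / 2) (((Nstar.card : ℝ) - N.card) / 2)) P := by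
    have hpi : HasLaw (fun ω (ν : ↥(Nstar \ N)) => z ν ω)
        (Measure.pi fun _ => stdGaussian (EuclideanSpace ℝ (Fin n))) P :=
      hindep.hasLaw_pi fun ν => hz ν ν.2
    have hbeta := map_residual_ratio_pi_stdGaussian (κ := ↥(Nstar \ N)) (regressorSpan x N) hyN
      (l := n - Nstar.card) (by omega) (by omega)
      (by rw [finrank_regressorSpan hlinN, hcard, finrank_euclideanSpace_fin]; omega)
    rw [hcard, hl, hk] at hbeta
    have hmeas : Measurable fun w : ↥(Nstar \ N) → EuclideanSpace ℝ (Fin n) =>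
        ‖y - (regressorSpan x N ⊔ Submodule.span ℝ (Set.range w)).starProjection y‖ ^ 2 /
          ‖y - (regressorSpan x N).starProjection y‖ ^ 2 :=
      (((measurable_norm_sub_starProjection_sup_span (regressorSpan x N)).comp
        (measurable_const.prodMk measurable_id)).pow_const 2).div_const _
    have hcomp := HasLaw.fun_comp ⟨hmeas.aemeasurable, hbeta⟩ hpi
    have hfun : (fun ω => residualSS y (replaceRegressors N x (fun ν => z ν ω)) Nstar /
        residualSS y x N) = fun ω =>
        ‖y - (regressorSpan x N ⊔ Submodule.span ℝ
          (Set.range fun ν : ↥(Nstar \ N) => z ν ω)).starProjection y‖ ^ 2 /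
          ‖y - (regressorSpan x N).starProjection y‖ ^ 2 := by
      ext ω
      simp only [residualSS, fittedVector, regressorSpan_replaceRegressors hsub]
    rw [hfun]
    exact hcomp
  refine ⟨hlaw, fun hlin' => ?_⟩
  have hSSstar := residualSS_pos (linearIndependent_responseAndRegressors_iff.1 hlin').2
  have := isProbabilityMeasureBeta (α := ((n : ℝ) - Nstar.card) / 2)
    (β := ((Nstar.card : ℝ) - N.card) / 2)
    (by rw [← hl]; have : 0 < n - Nstar.card := by omega
        positivity)
    (by rw [← hk]; have : 0 < Nstar.card - N.card := by omega
        positivity)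
  have hp : fTestPValue y x N Nstar =
      cdf (betaMeasure (((n : ℝ) - Nstar.card) / 2) (((Nstar.card : ℝ) - N.card) / 2))
        (residualSS y x Nstar / residualSS y x N) := by
    have h := one_sub_cdf_fisherMeasure (k := Nstar.card - N.card) (l := n - Nstar.card)
      (by omega) (by omega) (div_pos hSSstar hSSN)
    rw [hk, hl] at h
    rw [← h, fTestPValue, fStatistic]
    -- Dividing both residual sums in `F` by `residualSS y x N` leaves the statistic unchanged and
    -- writes it in terms of the ratio.
    congr 2
    have e1 : 1 - residualSS y x Nstar / residualSS y x N =
        (residualSS y x N - residualSS y x Nstar) / residualSS y x N := by field_simp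
    rw [e1, div_right_comm (_ - _) (residualSS y x N),
      div_right_comm (residualSS y x Nstar) (residualSS y x N), div_div_div_cancel_right₀ hSSN.ne']
  have hprob : P.real {ω | residualSS y (replaceRegressors N x (fun ν => z ν ω)) Nstar /
      residualSS y x N ≤ residualSS y x Nstar / residualSS y x N} = fTestPValue y x N Nstar := by
    rw [hp, cdf_eq_real]
    exact hlaw.measureReal_eq (p := fun t => t ≤ residualSS y x Nstar / residualSS y x N)
      measurableSet_Iic
  refine ⟨hp, hprob, ?_⟩
  rw [← hprob]
  congr 1
  ext ω
  simp only [Set.mem_ofPred_eq, sub_le_sub_iff_left, div_le_div_iff_of_pos_right hSSN]
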